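/- For $q$ with $0<|q|<1$ put $(a)_n=\prod_{i=0}^{n-1}(1-aq^i)$ for $n\ge 0$ and $(a)_\infty=\prod_{i\ge 0}(1-aq^i)$; in particular $(q)_n=\prod_{i=1}^{n}(1-q^i)$. For integers $d_1,d_2\ge 0$ let $$I_{d_1,d_2}(z_1,z_2)=\frac{(qz_1^{-1}z_2^{-1})_{d_1+d_2}}{(q)_{d_1}(q)_{d_2}(qz_1^{-1})_{d_1}(qz_2^{-1})_{d_2}(qz_1^{-1}z_2^{-1})_{d_1}(qz_1^{-1}z_2^{-1})_{d_2}},$$ and for $0\le n\le\min(d_1,d_2)$ let $$I_{d_1,d_2,n}(z_1,z_2)=\frac{1}{(q)_{d_1-n}(q)_{d_2-n}(q)_n}\cdot\frac{(qz_2)_\infty}{(qz_1^{-1})_{d_1-n}(qz_1^{-1}z_2^{-1})_n(q^{d_1-2n+1}z_2)_\infty(q^{-d_1+2n+1}z_2^{-1})_{d_2-n}(qz_2)_{d_1-n}(qz_2^{-1})_n}.$$ Then for all integers $d_1,d_2\ge 0$, $$I_{d_1,d_2}(z_1,z_2)=\sum_{n=0}^{\min(d_1,d_2)}I_{d_1,d_2,n}(z_1,z_2).$$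 Here $q,z_1,z_2$ are nonzero elements, with $|q|<1$, of an arbitrary complete normed field $K$ (a field complete with respect to a multiplicative norm $|\cdot|$) at which none of the displayed denominators vanishes. For example, $K=\mathbb{C}$; or $K=\mathbb{C}(z_1,z_2)((q))$ with the $q$-adic norm, which gives the identity for formal variables. -/

import Mathlib

noncomputable section

/-- The finite `q`-shifted factorial `(a)_n = ∏_{i=0}^{n-1} (1 - a q^i)`.
In particular `(q)_n` is `qPoch q q n`. -/
def qPoch {K : Type*} [Field K] (q a : K) (n : ℕ) : K :=
  ∏ i ∈ Finset.range n, (1 - a * q ^ i)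

/-- The infinite `q`-shifted factorial `(a)_∞ = ∏_{i ≥ 0} (1 - a q^i)`,
a convergent infinite product when `‖q‖ < 1` (see `multipliable_qPochInf`). -/
def qPochInf {K : Type*} [NormedField K] (q a : K) : K :=
  ∏' i : ℕ, (1 - a * q ^ i)

/-- The product defining `(a)_∞` converges, for every `a`, as soon as `‖q‖ < 1`. -/
theorem multipliable_qPochInf {K : Type*} [NormedField K] [CompleteSpace K]
    (q a : K) (hq : ‖q‖ < 1) : Multipliable (fun i : ℕ => 1 - a * q ^ i) := by
  have hs : Summable (fun i : ℕ => ‖-(a * q ^ i)‖) := by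
    simpa [norm_neg, norm_mul, norm_pow] using
      (summable_geometric_of_lt_one (norm_nonneg q) hq).mul_left ‖a‖
  simpa [sub_eq_add_neg] using multipliable_one_add_of_summable hs

/-- The denominator of `I_{d₁,d₂}(z₁,z₂)`. -/
def todaDen {K : Type*} [Field K] (q : K) (d₁ d₂ : ℕ) (z₁ z₂ : K) : K :=
  qPoch q q d₁ * qPoch q q d₂ *
    qPoch q (q * z₁⁻¹) d₁ * qPoch q (q * z₂⁻¹) d₂ *
    qPoch q (q * z₁⁻¹ * z₂⁻¹) d₁ * qPoch q (q * z₁⁻¹ * z₂⁻¹) d₂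

/-- `I_{d₁,d₂}(z₁,z₂)`. -/
def todaI {K : Type*} [Field K] (q : K) (d₁ d₂ : ℕ) (z₁ z₂ : K) : K :=
  qPoch q (q * z₁⁻¹ * z₂⁻¹) (d₁ + d₂) / todaDen q d₁ d₂ z₁ z₂

/-- The denominator of `I_{d₁,d₂,n}(z₁,z₂)`. -/
def todaTermDen {K : Type*} [NormedField K] (q : K) (d₁ d₂ n : ℕ) (z₁ z₂ : K) : K :=
  (qPoch q q (d₁ - n) * qPoch q q (d₂ - n) * qPoch q q n) *
  (qPoch q (q * z₁⁻¹) (d₁ - n) *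
    qPoch q (q * z₁⁻¹ * z₂⁻¹) n *
    qPochInf q (q ^ ((d₁ : ℤ) - 2 * (n : ℤ) + 1) * z₂) *
    qPoch q (q ^ (-(d₁ : ℤ) + 2 * (n : ℤ) + 1) * z₂⁻¹) (d₂ - n) *
    qPoch q (q * z₂) (d₁ - n) *
    qPoch q (q * z₂⁻¹) n)

/-- `I_{d₁,d₂,n}(z₁,z₂)`, used for `n ≤ min d₁ d₂` only. -/
def todaTerm {K : Type*} [NormedField K] (q : K) (d₁ d₂ n : ℕ) (z₁ z₂ : K) : K :=
  qPochInf q (q * z₂) / todaTermDen q d₁ d₂ n z₁ z₂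

end

/-! Put `a = z₁⁻¹`, `u = z₂⁻¹`, `m = d₁`, `N = d₂`, `A = u q⁻ᵐ`. In each summand the two infinite
products differ by finitely many factors. Cancelling them and reversing the finite product that
remains turns the sum into a terminating very-well-poised `₆φ₅` in base `A` with parameters `q⁻ᵐ`,
`q⁻ᵐ/a`, `q⁻ᴺ` (`todaTermDen_factors`). That series is summed by induction on `N`
(`sum_wellPoisedTerm`). Its sum satisfies the same first-order recurrence in `N` as the closed form,
because the difference of the two sides of the recurrence telescopes in `n`
(`wellPoised_certificate`, `wellPoisedLower_succ`). -/

lemma qPoch_succ {K : Type*} [Field K] (q a : K) (n : ℕ) :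
    qPoch q a (n + 1) = qPoch q a n * (1 - a * q ^ n) :=
  Finset.prod_range_succ _ _

lemma qPoch_zero {K : Type*} [Field K] (q a : K) : qPoch q a 0 = 1 :=
  Finset.prod_range_zero _

lemma qPoch_add {K : Type*} [Field K] (q a : K) (m n : ℕ) :
    qPoch q a (m + n) = qPoch q a m * qPoch q (a * q ^ m) n := by
  simp only [qPoch, Finset.prod_range_add, pow_add, mul_assoc]

lemma qPoch_one_add {K : Type*} [Field K] (q a : K) (n : ℕ) :
    qPoch q a (n + 1) = (1 - a) * qPoch q (a * q) n := by
  rw [add_comm, qPoch_add]; simp [qPoch]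

lemma qPoch_ne_zero_iff {K : Type*} [Field K] {q a : K} {n : ℕ} :
    qPoch q a n ≠ 0 ↔ ∀ i < n, 1 - a * q ^ i ≠ 0 := by
  simp [qPoch, Finset.prod_ne_zero_iff]

lemma qPoch_ne_zero_of_le {K : Type*} [Field K] {q a : K} {m n : ℕ} (h : qPoch q a n ≠ 0)
    (hmn : m ≤ n) : qPoch q a m ≠ 0 :=
  qPoch_ne_zero_iff.2 fun i hi => qPoch_ne_zero_iff.1 h i (hi.trans_le hmn)

lemma qPoch_self_ne_zero {K : Type*} [Field K] {q : K} (hq : ∀ i : ℕ, 1 - q ^ (i + 1) ≠ 0)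
    (n : ℕ) : qPoch q q n ≠ 0 :=
  qPoch_ne_zero_iff.2 fun i _ => by simpa [pow_succ'] using hq i

lemma qPochInf_eq_qPoch_mul {K : Type*} [NormedField K] [CompleteSpace K]
    (q a : K) (hq : ‖q‖ < 1) (n : ℕ) :
    qPochInf q a = qPoch q a n * qPochInf q (a * q ^ n) := by
  have h : Multipliable (fun i : ℕ => 1 - a * q ^ (i + n)) := by
    simpa only [pow_add, mul_assoc, mul_comm, mul_left_comm] using
      multipliable_qPochInf q (a * q ^ n) hq
  have := Multipliable.prod_mul_tprod_nat_mul' (f := fun i : ℕ => 1 - a * q ^ i) h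
  rw [qPochInf, ← this, qPoch, qPochInf]
  congr 2
  ext i
  ring

/-- Reversal of a `q`-shifted factorial with base `q ^ (1 - 2 n) / A`. -/
lemma qPoch_reverse {K : Type*} [Field K] {q A b : K} (hq : q ≠ 0) (n : ℕ)
    (hb : b * (A * q ^ (2 * n)) = q) :
    qPoch q b n * ((-A) ^ n * q ^ (n ^ 2 + n.choose 2)) = qPoch q (A * q ^ n) n := by
  have hpow : (-A) ^ n * q ^ (n ^ 2 + n.choose 2) =
      ∏ i ∈ Finset.range n, (-(A * q ^ n * q ^ i)) := by
    have : ∀ i, -(A * q ^ n * q ^ i) = (-A * q ^ n) * q ^ i := fun i => by ring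
    simp only [this]
    rw [Finset.prod_mul_distrib, Finset.prod_const, Finset.card_range, Finset.prod_pow_eq_pow_sum,
      Finset.sum_range_id, Nat.choose_two_right, mul_pow, ← pow_mul, pow_add, sq]
    ring
  rw [hpow, qPoch, qPoch, ← Finset.prod_range_reflect, ← Finset.prod_mul_distrib]
  refine Finset.prod_congr rfl fun i hi => ?_
  have hi : i < n := Finset.mem_range.1 hi
  -- After reflection the paired factors are `1 - x⁻¹` and `-x`, with `x = A q^(n+i)`.
  have : b * q ^ (n - 1 - i) * (A * q ^ n * q ^ i) = 1 := by
    have h2 : q * (b * q ^ (n - 1 - i) * (A * q ^ n * q ^ i)) = q * 1 := by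
      rw [mul_one]
      refine Eq.trans ?_ hb
      obtain ⟨k, rfl⟩ : ∃ k, n = i + k + 1 := ⟨n - i - 1, by omega⟩
      rw [show i + k + 1 - 1 - i = k by omega]
      ring
    exact mul_left_cancel₀ hq h2
  linear_combination this

/-! ### The terminating very-well-poised `₆φ₅` sum -/

/-- The part of the summand of the terminating very-well-poised `₆φ₅` series free of the
factors `1 - A q ^ j`. -/
def wellPoisedCoeff {K : Type*} [Field K] (q a u A : K) (m N n : ℕ) : K :=
  (-A) ^ n * q ^ (n ^ 2 + n.choose 2) /
    (qPoch q q (m - n) * qPoch q q (N - n) * qPoch q q n * qPoch q (q * a) (m - n) *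
      qPoch q (q * a * u) n * qPoch q (q * u) n)

/-- The summand of the terminating very-well-poised `₆φ₅` series. -/
def wellPoisedTerm {K : Type*} [Field K] (q a u A : K) (m N n : ℕ) : K :=
  wellPoisedCoeff q a u A m N n / (qPoch q (A * q ^ n) n * qPoch q (A * q ^ (2 * n + 1)) (N - n))

/-- The nonvanishing of the denominators of all summands. -/
structure WellPoisedRegular {K : Type*} [Field K] (q a u A : K) (m N : ℕ) : Prop where
  left : qPoch q (q * a) m ≠ 0
  right : qPoch q (q * u) N ≠ 0
  prodLeft : qPoch q (q * a * u) m ≠ 0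
  prodRight : qPoch q (q * a * u) N ≠ 0
  -- The index `2 * n` is exempt: `1 - A q^(2n)` is the very-well-poised numerator factor, already
  -- cancelled in `wellPoisedTerm`.
  base : ∀ n ≤ min m N, ∀ j, n ≤ j → j ≤ N + n → j ≠ 2 * n → 1 - A * q ^ j ≠ 0

lemma WellPoisedRegular.of_succ {K : Type*} [Field K] {q a u A : K} {m N : ℕ}
    (h : WellPoisedRegular q a u A m (N + 1)) : WellPoisedRegular q a u A m N where
  left := h.left
  right := qPoch_ne_zero_of_le h.right N.le_succ
  prodLeft := h.prodLeft
  prodRight := qPoch_ne_zero_of_le h.prodRight N.le_succ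
  base n hn j h1 h2 h3 := h.base n (by omega) j h1 (by omega) h3

/-- The upper half of the telescoping certificate. -/
def wellPoisedUpper {K : Type*} [Field K] (q a u A : K) (m N n : ℕ) : K :=
  wellPoisedCoeff q a u A m N n *
    (A * q ^ N * (1 - q ^ (m - n)) * (1 - a * q ^ (m - n)) * (1 - q ^ (N - n)) * q ^ (2 * n)) /
    qPoch q (A * q ^ (n + 1)) N

/-- The lower half of the telescoping certificate. -/
def wellPoisedLower {K : Type*} [Field K] (q a u A : K) (m N n : ℕ) : K :=
  wellPoisedCoeff q a u A m N n *
    (-(q ^ (N - n) * (1 - q ^ n) * (1 - u * q ^ n) * (1 - a * u * q ^ n))) /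
    qPoch q (A * q ^ n) N

lemma wellPoisedLower_zero {K : Type*} [Field K] (q a u A : K) (m N : ℕ) :
    wellPoisedLower q a u A m N 0 = 0 := by
  simp [wellPoisedLower]

lemma wellPoisedUpper_min {K : Type*} [Field K] (q a u A : K) (m N : ℕ) :
    wellPoisedUpper q a u A m N (min m N) = 0 := by
  rcases min_choice m N with h | h <;> rw [h] <;> simp [wellPoisedUpper]

lemma wellPoisedLower_succ {K : Type*} [Field K] {q a u A : K} {m N n : ℕ}
    (hq : ∀ i : ℕ, 1 - q ^ (i + 1) ≠ 0) (h : WellPoisedRegular q a u A m N)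
    (hn : n < min m N) :
    wellPoisedLower q a u A m N (n + 1) = wellPoisedUpper q a u A m N n := by
  have hm : n < m := by omega
  have hN : n < N := by omega
  have e1 := qPoch_ne_zero_iff.1 h.prodRight n hN
  have e2 := qPoch_ne_zero_iff.1 h.right n hN
  have e3 := qPoch_ne_zero_iff.1 h.left (m - n - 1) (by omega)
  have hl := qPoch_ne_zero_of_le h.left (show m - n - 1 ≤ m by omega)
  have hr := qPoch_ne_zero_of_le h.right hN.le
  have hp := qPoch_ne_zero_of_le h.prodRight hN.le
  unfold wellPoisedLower wellPoisedUpper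
  congr 1
  unfold wellPoisedCoeff
  obtain ⟨k, rfl⟩ : ∃ k, m = n + k + 1 := ⟨m - n - 1, by omega⟩
  obtain ⟨l, rfl⟩ : ∃ l, N = n + l + 1 := ⟨N - n - 1, by omega⟩
  rw [show n + k + 1 - (n + 1) = k by omega, show n + l + 1 - (n + 1) = l by omega,
    show n + k + 1 - n = k + 1 by omega, show n + l + 1 - n = l + 1 by omega]
  rw [show n + k + 1 - n - 1 = k by omega] at e3 hl
  have f1 := hq k
  have f2 := hq l
  have f3 := hq n
  have g1 := qPoch_self_ne_zero hq k
  have g2 := qPoch_self_ne_zero hq l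
  have g3 := qPoch_self_ne_zero hq n
  have c2 : (n + 1).choose 2 = n + n.choose 2 := by
    rw [Nat.choose_succ_succ' n 1, Nat.choose_one_right]
  simp only [qPoch_succ, c2]
  simp only [show q * q ^ k = q ^ (k + 1) by ring, show q * q ^ l = q ^ (l + 1) by ring,
    show q * q ^ n = q ^ (n + 1) by ring]
  rw [div_mul_eq_mul_div, div_mul_eq_mul_div, div_eq_div_iff (by positivity) (by positivity)]
  ring

/-- The bracket is the multiplier that remains once the `N`-summand is written as a multiple of the
`(N + 1)`-summand. `A * q ^ m = u` is the well-poised condition behind the final polynomial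
identity. -/
lemma wellPoised_certificate {K : Type*} [Field K] {q a u A : K} {m N n : ℕ}
    (hA : A * q ^ m = u)
    (h : WellPoisedRegular q a u A m (N + 1)) (hn : n ≤ min m (N + 1)) :
    wellPoisedTerm q a u A m (N + 1) n *
      ((1 - q ^ (N + 1)) * (1 - u * q ^ (N + 1)) * (1 - a * u * q ^ (N + 1)) -
        (1 - a * u * q ^ (m + N + 1)) * ((1 - q ^ (N + 1 - n)) * (1 - A * q ^ (N + 1 + n)))) =
    wellPoisedUpper q a u A m (N + 1) n - wellPoisedLower q a u A m (N + 1) n := by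
  unfold wellPoisedTerm wellPoisedUpper wellPoisedLower
  generalize wellPoisedCoeff q a u A m (N + 1) n = C
  have hb := h.base n hn
  have n1 : qPoch q (A * q ^ n) n ≠ 0 := qPoch_ne_zero_iff.2 fun i hi => by
    rw [mul_assoc, ← pow_add]; exact hb _ (by omega) (by omega) (by omega)
  have n2 : qPoch q (A * q ^ (2 * n + 1)) (N + 1 - n) ≠ 0 := qPoch_ne_zero_iff.2 fun i hi => by
    rw [mul_assoc, ← pow_add]; exact hb _ (by omega) (by omega) (by omega)
  obtain ⟨k, rfl⟩ : ∃ k, m = n + k := ⟨m - n, by omega⟩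
  rw [show n + k - n = k by omega]
  subst hA
  -- `1 - A` may vanish, but at `n = 0` the lower half, which alone would contain it, is zero.
  rcases Nat.eq_zero_or_pos n with rfl | hpos
  · simp only [pow_zero, mul_one, Nat.sub_zero, mul_zero, zero_add, qPoch_zero, add_zero,
      pow_one, one_mul, sub_self, zero_mul, neg_zero, zero_div, sub_zero] at n2 ⊢
    rw [div_mul_eq_mul_div]
    congr 1
    ring
  obtain ⟨l, hl⟩ : ∃ l, N + 1 = n + l := ⟨N + 1 - n, by omega⟩
  rw [hl, show n + k + N + 1 = n + k + (n + l) by omega, show n + l - n = l by omega]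
  rw [show N + 1 - n = l by omega] at n2
  -- At `n = N + 1` the upper half is zero, and the lower denominator stops just before `1 - A
  -- q^(2n)`.
  rcases Nat.eq_zero_or_pos l with rfl | hlpos
  · simp only [add_zero, qPoch_zero, pow_zero, sub_self, mul_zero, zero_mul, zero_div, mul_one,
      sub_zero, one_mul, zero_sub]
    rw [div_mul_eq_mul_div, ← neg_div]
    congr 1
    ring
  -- Regularity of summand `n` says nothing about this factor; that of its neighbour `n - 1` does.
  have n0 : 1 - A * q ^ (2 * n) ≠ 0 :=
    h.base (n - 1) (by omega) _ (by omega) (by omega) (by omega)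
  have n3 : 1 - A * q ^ n ≠ 0 := hb n le_rfl (by omega) (by omega)
  have n4 : 1 - A * q ^ (2 * n + l) ≠ 0 := hb _ (by omega) (by omega) (by omega)
  have all : qPoch q (A * q ^ n) (n + l + 1) =
      qPoch q (A * q ^ n) n * ((1 - A * q ^ (2 * n)) * qPoch q (A * q ^ (2 * n + 1)) l) := by
    rw [show n + l + 1 = n + (l + 1) by ring, qPoch_add, qPoch_one_add]
    ring_nf
  have allU : (1 - A * q ^ n) * qPoch q (A * q ^ (n + 1)) (n + l) =
      qPoch q (A * q ^ n) n * ((1 - A * q ^ (2 * n)) * qPoch q (A * q ^ (2 * n + 1)) l) := by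
    rw [← all, qPoch_one_add, pow_succ, mul_assoc]
  have allL : qPoch q (A * q ^ n) (n + l) * (1 - A * q ^ (2 * n + l)) =
      qPoch q (A * q ^ n) n * ((1 - A * q ^ (2 * n)) * qPoch q (A * q ^ (2 * n + 1)) l) := by
    rw [← all, qPoch_succ]
    ring_nf
  have dU := eq_div_of_mul_eq n3 ((mul_comm _ _).trans allU)
  have dL := eq_div_of_mul_eq n4 allL
  rw [dU, dL]
  field_simp
  ring

/-- The terminating very-well-poised `₆φ₅` summation. -/
theorem sum_wellPoisedTerm {K : Type*} [Field K] {q a u A : K} {m N : ℕ}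
    (hA : A * q ^ m = u) (hq : ∀ i : ℕ, 1 - q ^ (i + 1) ≠ 0)
    (h : WellPoisedRegular q a u A m N) :
    ∑ n ∈ Finset.range (min m N + 1), wellPoisedTerm q a u A m N n =
      qPoch q (q * a * u) (m + N) /
        (qPoch q q m * qPoch q q N * qPoch q (q * a) m * qPoch q (q * u) N *
          qPoch q (q * a * u) m * qPoch q (q * a * u) N) := by
  induction N with
  | zero =>
    have := h.prodLeft
    have := h.left
    have := qPoch_self_ne_zero hq m
    simp [wellPoisedTerm, wellPoisedCoeff, qPoch_zero]
    field_simp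
  | succ N ih =>
    have ih := ih h.of_succ
    -- `d / c` is the ratio of the closed forms at `N + 1` and `N`.
    set c := (1 - q ^ (N + 1)) * (1 - u * q ^ (N + 1)) * (1 - a * u * q ^ (N + 1)) with hc
    set d := 1 - a * u * q ^ (m + N + 1) with hd
    have tele : ∀ M ≤ min m (N + 1), ∑ n ∈ Finset.range M,
        (wellPoisedUpper q a u A m (N + 1) n - wellPoisedLower q a u A m (N + 1) n) =
        wellPoisedLower q a u A m (N + 1) M := by
      intro M hM
      rw [Finset.sum_congr rfl fun n hn => by
        rw [← wellPoisedLower_succ hq h ((Finset.mem_range.1 hn).trans_le hM)],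
        Finset.sum_range_sub, wellPoisedLower_zero, sub_zero]
    have step : ∑ n ∈ Finset.range (min m (N + 1) + 1), wellPoisedTerm q a u A m (N + 1) n *
        (c - d * ((1 - q ^ (N + 1 - n)) * (1 - A * q ^ (N + 1 + n)))) = 0 := by
      rw [Finset.sum_congr rfl fun n hn => wellPoised_certificate hA h
        (Nat.lt_succ_iff.1 (Finset.mem_range.1 hn)), Finset.sum_range_succ, tele _ le_rfl,
        wellPoisedUpper_min]
      ring
    have lower : ∀ n ≤ min m N, wellPoisedTerm q a u A m (N + 1) n *
        ((1 - q ^ (N + 1 - n)) * (1 - A * q ^ (N + 1 + n))) = wellPoisedTerm q a u A m N n := by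
      intro n hn
      have hnz : 1 - A * q ^ (N + 1 + n) ≠ 0 :=
        h.base n (by omega) _ (by omega) (by omega) (by omega)
      have hqn := hq (N - n)
      unfold wellPoisedTerm wellPoisedCoeff
      rw [show N + 1 - n = N - n + 1 by omega, qPoch_succ, qPoch_succ,
        show q * q ^ (N - n) = q ^ (N - n + 1) by ring,
        show A * q ^ (2 * n + 1) * q ^ (N - n) = A * q ^ (N + 1 + n) by
          rw [mul_assoc, ← pow_add]; congr 2; omega,
        div_div, div_div, div_mul_eq_mul_div]
      refine Eq.trans ?_ (mul_div_mul_right _ _ (mul_ne_zero hqn hnz))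
      congr 1
      ring
    have low : ∑ n ∈ Finset.range (min m (N + 1) + 1), wellPoisedTerm q a u A m (N + 1) n *
        ((1 - q ^ (N + 1 - n)) * (1 - A * q ^ (N + 1 + n))) =
        ∑ n ∈ Finset.range (min m N + 1), wellPoisedTerm q a u A m N n := by
      rw [← Finset.sum_congr rfl fun n hn =>
        lower n (Nat.lt_succ_iff.1 (Finset.mem_range.1 hn))]
      symm
      refine Finset.sum_subset (Finset.range_mono (by omega)) fun n h1 h2 => ?_
      simp only [Finset.mem_range] at h1 h2
      -- The only possible extra index is `n = N + 1`, where `1 - q^(N+1-n)` vanishes.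
      simp [show N + 1 - n = 0 by omega]
    have main : (∑ n ∈ Finset.range (min m (N + 1) + 1), wellPoisedTerm q a u A m (N + 1) n) * c =
        d * ∑ n ∈ Finset.range (min m N + 1), wellPoisedTerm q a u A m N n := by
      rw [← low, ← sub_eq_zero, Finset.sum_mul, Finset.mul_sum, ← Finset.sum_sub_distrib, ← step]
      exact Finset.sum_congr rfl fun n _ => by ring
    have e1 := hq N
    have e2 := qPoch_ne_zero_iff.1 h.right N N.lt_succ_self
    have e3 := qPoch_ne_zero_iff.1 h.prodRight N N.lt_succ_self
    rw [show q * u * q ^ N = u * q ^ (N + 1) by ring] at e2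
    rw [show q * a * u * q ^ N = a * u * q ^ (N + 1) by ring] at e3
    have hc0 : c ≠ 0 := mul_ne_zero (mul_ne_zero e1 e2) e3
    rw [ih] at main
    rw [eq_div_of_mul_eq hc0 main, ← add_assoc]
    simp only [qPoch_succ]
    rw [show q * u * q ^ N = u * q ^ (N + 1) by ring,
      show q * a * u * q ^ N = a * u * q ^ (N + 1) by ring,
      show q * a * u * q ^ (m + N) = a * u * q ^ (m + N + 1) by ring,
      show q * q ^ N = q ^ (N + 1) by ring, hc, ← hd, mul_div_assoc', div_div]
    congr 1
    · ring
    · ring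

/-! ### Reduction of the original summands to the `₆φ₅` series -/

/-- Both infinite products in a summand cancel, leaving a finite one. -/
lemma qPochInf_mul_qPoch {K : Type*} [NormedField K] [CompleteSpace K] {q w b : K}
    (hq : ‖q‖ < 1) {k n : ℕ} (hb : b * q ^ n = q * w * q ^ k) :
    qPochInf q b * qPoch q (q * w) k = qPochInf q (q * w) * qPoch q b n := by
  rw [qPochInf_eq_qPoch_mul q b hq n, qPochInf_eq_qPoch_mul q (q * w) hq k, hb]
  ring

lemma todaTermDen_factors {K : Type*} [NormedField K] [CompleteSpace K] {q z₁ z₂ : K}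
    {d₁ d₂ n : ℕ} (hq₀ : q ≠ 0) (hq₁ : ‖q‖ < 1) (hz₂ : z₂ ≠ 0) (hn : n ≤ min d₁ d₂)
    (h : todaTermDen q d₁ d₂ n z₁ z₂ ≠ 0) :
    qPoch q (z₂⁻¹ / q ^ d₁ * q ^ n) n ≠ 0 ∧
      qPoch q (z₂⁻¹ / q ^ d₁ * q ^ (2 * n + 1)) (d₂ - n) ≠ 0 ∧
      todaTerm q d₁ d₂ n z₁ z₂ = wellPoisedTerm q z₁⁻¹ z₂⁻¹ (z₂⁻¹ / q ^ d₁) d₁ d₂ n := by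
  have hA0 : z₂⁻¹ / q ^ d₁ ≠ 0 := div_ne_zero (inv_ne_zero hz₂) (pow_ne_zero _ hq₀)
  have hexp : q ^ ((d₁ : ℤ) - 2 * (n : ℤ) + 1) = q ^ d₁ * q / q ^ (2 * n) := by
    rw [zpow_add₀ hq₀, zpow_sub₀ hq₀, zpow_one, zpow_natCast]
    norm_cast
    ring
  have hexp' : q ^ (-(d₁ : ℤ) + 2 * (n : ℤ) + 1) * z₂⁻¹ =
      z₂⁻¹ / q ^ d₁ * q ^ (2 * n + 1) := by
    rw [zpow_add₀ hq₀, zpow_add₀ hq₀, zpow_one, zpow_neg, zpow_natCast, pow_succ]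
    norm_cast
    field_simp
  have hrev := qPoch_reverse (A := z₂⁻¹ / q ^ d₁) (b := q ^ ((d₁ : ℤ) - 2 * (n : ℤ) + 1) * z₂) hq₀ n (by
    rw [hexp]; field_simp)
  have hinf := qPochInf_mul_qPoch (b := q ^ ((d₁ : ℤ) - 2 * (n : ℤ) + 1) * z₂) (w := z₂) hq₁
    (k := d₁ - n) (n := n) (by
      obtain ⟨k, rfl⟩ : ∃ k, d₁ = n + k := ⟨d₁ - n, by omega⟩
      rw [hexp, show n + k - n = k by omega]
      field_simp
      ring)
  have hκ : (-(z₂⁻¹ / q ^ d₁)) ^ n * q ^ (n ^ 2 + n.choose 2) ≠ 0 :=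
    mul_ne_zero (pow_ne_zero _ (neg_ne_zero.2 hA0)) (pow_ne_zero _ hq₀)
  unfold todaTerm
  unfold todaTermDen at h ⊢
  rw [hexp'] at h ⊢
  generalize q ^ ((d₁ : ℤ) - 2 * (n : ℤ) + 1) * z₂ = b at *
  simp only [ne_eq, mul_eq_zero, not_or] at h
  obtain ⟨⟨⟨h1, h2⟩, h3⟩, ⟨⟨⟨⟨h4, h5⟩, h6⟩, h7⟩, h8⟩, h9⟩ := h
  -- The numerator `(q z₂)_∞` and the factor `(b)_n` are not in the denominator; their nonvanishing
  -- follows from the cancellation identity.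
  have hprod : qPochInf q (q * z₂) * qPoch q b n ≠ 0 := hinf ▸ mul_ne_zero h6 h8
  have hi := left_ne_zero_of_mul hprod
  have hbn := right_ne_zero_of_mul hprod
  refine ⟨hrev ▸ mul_ne_zero hbn hκ, h7, ?_⟩
  unfold wellPoisedTerm wellPoisedCoeff
  rw [← hrev, div_div, div_eq_div_iff (by simp [*]) (by
    simp only [ne_eq, mul_eq_zero, not_or]; exact ⟨⟨⟨⟨⟨⟨h1, h2⟩, h3⟩, h4⟩, h5⟩, h9⟩,
      ⟨hbn, left_ne_zero_of_mul hκ, right_ne_zero_of_mul hκ⟩, h7⟩)]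
  linear_combination (-(-(z₂⁻¹ / q ^ d₁)) ^ n * q ^ (n ^ 2 + n.choose 2) *
    (qPoch q q (d₁ - n) * qPoch q q (d₂ - n) * qPoch q q n * qPoch q (q * z₁⁻¹) (d₁ - n) *
      qPoch q (q * z₁⁻¹ * z₂⁻¹) n * qPoch q (q * z₂⁻¹) n *
      qPoch q (z₂⁻¹ / q ^ d₁ * q ^ (2 * n + 1)) (d₂ - n))) * hinf

theorem mainTheorem9 {K : Type*} [NormedField K] [CompleteSpace K]
    (q z₁ z₂ : K) (hq₀ : q ≠ 0) (hq₁ : ‖q‖ < 1) (hz₁ : z₁ ≠ 0) (hz₂ : z₂ ≠ 0)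
    (d₁ d₂ : ℕ)
    (hden : todaDen q d₁ d₂ z₁ z₂ ≠ 0)
    (htermDen : ∀ n ≤ min d₁ d₂, todaTermDen q d₁ d₂ n z₁ z₂ ≠ 0) :
    todaI q d₁ d₂ z₁ z₂ =
      ∑ n ∈ Finset.range (min d₁ d₂ + 1), todaTerm q d₁ d₂ n z₁ z₂ := by
  have hq (i : ℕ) : 1 - q ^ (i + 1) ≠ 0 := fun h => by
    have : ‖q ^ (i + 1)‖ = 1 := by rw [← sub_eq_zero.1 h, norm_one]
    rw [norm_pow] at this
    exact (pow_lt_one₀ (norm_nonneg q) hq₁ i.succ_ne_zero).ne this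
  have hfac n (hn : n ≤ min d₁ d₂) := todaTermDen_factors hq₀ hq₁ hz₂ hn (htermDen n hn)
  have hA : z₂⁻¹ / q ^ d₁ * q ^ d₁ = z₂⁻¹ := div_mul_cancel₀ _ (pow_ne_zero _ hq₀)
  unfold todaDen at hden
  simp only [ne_eq, mul_eq_zero, not_or] at hden
  obtain ⟨⟨⟨⟨⟨-, -⟩, h1⟩, h2⟩, h3⟩, h4⟩ := hden
  have hreg : WellPoisedRegular q z₁⁻¹ z₂⁻¹ (z₂⁻¹ / q ^ d₁) d₁ d₂ :=
    ⟨h1, h2, h3, h4, fun n hn j hj1 hj2 hj3 => by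
      -- Indices below `2 * n` occur in `(A q^n)_n`, those above in `(A q^(2n+1))_(d₂-n)`.
      rcases lt_or_gt_of_ne hj3 with hlt | hgt
      · have := qPoch_ne_zero_iff.1 (hfac n hn).1 (j - n) (by omega)
        rwa [mul_assoc, ← pow_add, show n + (j - n) = j by omega] at this
      · have := qPoch_ne_zero_iff.1 (hfac n hn).2.1 (j - (2 * n + 1)) (by omega)
        rwa [mul_assoc, ← pow_add, show 2 * n + 1 + (j - (2 * n + 1)) = j by omega] at this⟩
  rw [Finset.sum_congr rfl fun n hn =>
    (hfac n (Nat.lt_succ_iff.1 (Finset.mem_range.1 hn))).2.2, sum_wellPoisedTerm hA hq hreg]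
  rfl
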